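/- Let $d \ge 3$ be fixed. For $n \ge 1$ consider the $d$-dimensional grid $(\mathbb{Z}/n\mathbb{Z})^d$ with periodic boundary conditions, which has $N = n^d$ vertices, and the space $\mathbb{C}^{2d} \otimes \mathbb{C}^{N}$ spanned by $|i_\pm\rangle \otimes |x\rangle$, with $1 \le i \le d$ and $x \in (\mathbb{Z}/n\mathbb{Z})^d$. Let $S$ be the flip-flop shift $S\,|i_\pm\rangle \otimes |x\rangle = |i_\mp\rangle \otimes |x \pm e_i\rangle$. Let $|s\rangle = \frac{1}{\sqrt{2d}} \sum_{i,\pm} |i_\pm\rangle$ and $C_0 = 2|s\rangle\langle s| - I$. For a marked vertex $v$ let $U'_v = S\,\bigl(C_0 \otimes (I - |v\rangle\langle v|) - I \otimes |v\rangle\langle v|\bigr)$ be the perturbed quantum walk, and let $|\Phi_0\rangle$ be the uniform superposition of all $2dN$ basis states. Then there are constants $C, p > 0$ depending only on $d$ such that for every $n \ge 1$ there is an integer $T \ge 0$ with $T \le C\sqrt{N}$ such that, for every vertex $v$, measuring the position register of $(U'_v)^T |\Phi_0\rangle$ gives the marked vertex $v$ with probability at least $p$. Moreover, for $k \in \{0,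 \ldots, n-1\}^d$ let $\theta_k \in [0, \pi]$ be defined by $\cos\theta_k = \frac{1}{d} \sum_{i=1}^d \cos\frac{2\pi k_i}{n}$. Then there are constants $a, b > 0$ depending only on $d$ such that, for all $n \ge 2$, $$a N \;\le\; \sum_{k \ne 0} \frac{1}{1 - \cos\theta_k} \;\le\; b N .$$ -/

import Mathlib

open scoped Matrix Kronecker

noncomputable section

namespace GridSearch

/-- Vertices of the `d`-dimensional periodic grid of side length `n`; there are `n ^ d` of them. -/
abbrev Vertex (d n : ℕ) : Type := Fin d → ZMod n

/-- The `2 * d` directions: `(i, true)` is the positive and `(i, false)` the negative direction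
along the `i`-th axis. They index the basis of the coin space. -/
abbrev Direction (d : ℕ) : Type := Fin d × Bool

/-- Basis labels of the joint space of coin and position, `|direction⟩ ⊗ |vertex⟩`. -/
abbrev Label (d n : ℕ) : Type := Direction d × Vertex d n

/-- The neighbour of `x` in a given direction (periodic boundary conditions). -/
def neighbor {d n : ℕ} (e : Direction d) (x : Vertex d n) : Vertex d n :=
  if e.2 then x + Pi.single e.1 1 else x - Pi.single e.1 1

/-- The action of the flip-flop shift on labels: move along the direction, then reverse it. -/
def flipFlop {d n : ℕ} (b : Label d n) : Label d n :=
  ((b.1.1, !b.1.2), neighbor b.1 b.2)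

/-- The flip-flop shift operator `S`, which sends the basis state `b` to `flipFlop b`. -/
def shift (d n : ℕ) : Matrix (Label d n) (Label d n) ℂ :=
  Matrix.of fun b' b => if b' = flipFlop b then 1 else 0

/-- The uniform coin state `|s⟩`. -/
def coinUniform (d : ℕ) : Direction d → ℂ := fun _ => 1 / (√(2 * d : ℝ) : ℂ)

/-- The coin flip `C₀ = 2 |s⟩⟨s| - I`. -/
def coinFlip (d : ℕ) : Matrix (Direction d) (Direction d) ℂ :=
  (2 : ℂ) • Matrix.vecMulVec (coinUniform d) (star (coinUniform d)) - 1

/-- The marking coin `C₁ = - I`. -/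
def markingCoin (d : ℕ) : Matrix (Direction d) (Direction d) ℂ := -1

/-- The projection `|v⟩⟨v|` on the position space. -/
def vertexProj {d n : ℕ} (v : Vertex d n) : Matrix (Vertex d n) (Vertex d n) ℂ :=
  Matrix.single v v 1

/-- The perturbed coin operator `C' = C₀ ⊗ (I - |v⟩⟨v|) + C₁ ⊗ |v⟩⟨v|`. -/
def perturbedCoin {d n : ℕ} (v : Vertex d n) : Matrix (Label d n) (Label d n) ℂ :=
  coinFlip d ⊗ₖ (1 - vertexProj v) + markingCoin d ⊗ₖ vertexProj v

/-- One step `U' = S C'` of the perturbed quantum walk with marked vertex `v`. -/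
def walkStep {d n : ℕ} [NeZero n] (v : Vertex d n) : Matrix (Label d n) (Label d n) ℂ :=
  shift d n * perturbedCoin v

/-- The uniform superposition `|Φ₀⟩` over all `2 d N` basis states, where `N = n ^ d`. -/
def initialState (d n : ℕ) : Label d n → ℂ := fun _ => 1 / (√(2 * d * (n : ℝ) ^ d) : ℂ)

/-- The state `(U') ^ T |Φ₀⟩` of the search algorithm after `T` steps. -/
def stateAfter {d n : ℕ} [NeZero n] (v : Vertex d n) (T : ℕ) : Label d n → ℂ :=
  (walkStep v ^ T) *ᵥ initialState d n

/-- The probability that measuring the position register after `T` steps gives the marked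
vertex `v`. -/
def successProb {d n : ℕ} [NeZero n] (v : Vertex d n) (T : ℕ) : ℝ :=
  ∑ e : Direction d, ‖stateAfter v T (e, v)‖ ^ 2

/-- The angle `θ_k ∈ [0, π]` of the Fourier mode `k`, with
`cos θ_k = (1 / d) ∑ i, cos (2 π k_i / n)`. -/
def modeAngle {d n : ℕ} (k : Fin d → ZMod n) : ℝ :=
  Real.arccos ((1 / (d : ℝ)) * ∑ i, Real.cos (2 * Real.pi * ((k i).val : ℝ) / (n : ℝ)))

end GridSearch

end

namespace GridSearch

/-! No spectral decomposition of the walk is used; the search time comes from a resolvent (Abel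
summation) argument. Write `N = n ^ d`, drop the normalisation of the initial state, and let `U` be
the real step with marked vertex `0`, `r = 1 - 1 / √N`, and `u` the indicator of the unmarked
vertices. The equation `G - r U G = u` has an explicit solution in terms of a function `h` on the
torus that vanishes at `0` and satisfies `(1 + ε) h - P h = 1` elsewhere, where `P` is the simple
random walk and `ε = (1 - r)² / (2 r)`. The mean of `G` at the marked vertex is `P h 0 / 2`; since
`P` preserves sums, it is of order `N` as soon as the walk killed at `0` has spectral gap at least
of order `1 / N` (`exists_discounted_sum`). Since `G` is the discounted sum of the `U ^ t u`, whose
weights add up to at most `√N`, some `U ^ t u` with `t = O(√N)` has mean of order `√N` at `0`; the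
tail is small because `U` is an isometry (`exists_large_meanAtZero`). After normalisation this is
constant probability. The gap follows from the bound on `∑ 1 / (1 - cos θ_k)`. If `f 0 = 0`, the
Fourier coefficients of `f` sum to zero, so the zero mode is controlled by the others, and
Cauchy–Schwarz gives the estimate (`dirichlet_gap`). The upper bound on the sum is where `d ≥ 3` is
essential. -/

variable {d n : ℕ}

/-! ### Two-sided bounds for the sum of `1 / (1 - cos θ_k)`. -/

lemma cos_modeAngle (k : Vertex d n) :
    Real.cos (modeAngle k) =
      (1 / (d : ℝ)) * ∑ i, Real.cos (2 * Real.pi * ((k i).val : ℝ) / (n : ℝ)) := by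
  have h : |∑ i, Real.cos (2 * Real.pi * ((k i).val : ℝ) / (n : ℝ))| ≤ d := by
    refine (Finset.abs_sum_le_sum_abs _ _).trans ?_
    refine (Finset.sum_le_sum fun i _ => Real.abs_cos_le_one _).trans ?_
    simp
  have h' : |(1 / (d : ℝ)) * ∑ i, Real.cos (2 * Real.pi * ((k i).val : ℝ) / (n : ℝ))| ≤ 1 := by
    rw [abs_mul, abs_of_nonneg (by positivity), one_div_mul_eq_div]
    exact div_le_one_of_le₀ h (by positivity)
  exact Real.cos_arccos (abs_le.1 h').1 (abs_le.1 h').2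

lemma cos_val_eq_cos_valMinAbs [NeZero n] (a : ZMod n) :
    Real.cos (2 * Real.pi * (a.val : ℝ) / n) = Real.cos (2 * Real.pi * (a.valMinAbs : ℝ) / n) := by
  have h : (((a.val : ℤ) : ZMod n)) = ((a.valMinAbs : ℤ) : ZMod n) := by simp
  obtain ⟨c, hc⟩ := (ZMod.intCast_eq_intCast_iff_dvd_sub _ _ _).1 h
  have hn : (n : ℝ) ≠ 0 := NeZero.ne _
  have hc' : (a.valMinAbs : ℝ) = a.val + n * c := by
    have : a.valMinAbs = a.val + n * c := by linarith
    exact_mod_cast this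
  rw [hc', ← Real.cos_add_int_mul_two_pi _ c]
  congr 1
  field_simp

lemma abs_valMinAbs_le [NeZero n] (a : ZMod n) : |(a.valMinAbs : ℝ)| ≤ n / 2 := by
  have h := a.natAbs_valMinAbs_le
  have h1 : a.valMinAbs.natAbs * 2 ≤ n := (Nat.le_div_iff_mul_le two_pos).1 h
  have h2 : ((a.valMinAbs.natAbs : ℕ) : ℝ) * 2 ≤ n := by exact_mod_cast h1
  rw [Nat.cast_natAbs, Int.cast_abs] at h2
  linarith

/-- The representative of least absolute value puts the angle in `[-π, π]`, where `1 - cos t ≥ 2 t²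
/ π²`; the other coordinates contribute nonnegative terms to the average. -/
lemma le_one_sub_cos_modeAngle [NeZero n] (hd : 0 < d) (k : Vertex d n) (i : Fin d) :
    8 * ((k i).valMinAbs : ℝ) ^ 2 / (d * n ^ 2) ≤ 1 - Real.cos (modeAngle k) := by
  have hd' : (0 : ℝ) < d := by exact_mod_cast hd
  have hn : (0 : ℝ) < n := by exact_mod_cast NeZero.pos n
  have key (i : Fin d) : 8 * ((k i).valMinAbs : ℝ) ^ 2 / n ^ 2 ≤
      1 - Real.cos (2 * Real.pi * ((k i).val : ℝ) / n) := by
    rw [cos_val_eq_cos_valMinAbs]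
    have h : |2 * Real.pi * ((k i).valMinAbs : ℝ) / n| ≤ Real.pi := by
      rw [abs_div, abs_mul, abs_of_pos hn, abs_of_pos Real.two_pi_pos, div_le_iff₀ hn]
      nlinarith [abs_valMinAbs_le (k i), Real.pi_pos]
    have := Real.cos_le_one_sub_mul_cos_sq h
    have e : 2 / Real.pi ^ 2 * (2 * Real.pi * ((k i).valMinAbs : ℝ) / n) ^ 2 =
        8 * ((k i).valMinAbs : ℝ) ^ 2 / n ^ 2 := by
      field_simp
      ring
    linarith
  have h1 : 1 - Real.cos (modeAngle k) =
      (∑ i, (1 - Real.cos (2 * Real.pi * ((k i).val : ℝ) / n))) / d := by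
    rw [cos_modeAngle, Finset.sum_sub_distrib]
    simp
    field_simp
  have h2 := Finset.single_le_sum (f := fun i => 1 - Real.cos (2 * Real.pi * ((k i).val : ℝ) / n))
    (fun i _ => sub_nonneg.2 (Real.cos_le_one _)) (Finset.mem_univ i)
  rw [h1, le_div_iff₀ hd']
  refine le_trans (le_of_eq ?_) ((key i).trans h2)
  field_simp

lemma one_sub_cos_modeAngle_pos [NeZero n] (hd : 0 < d) {k : Vertex d n} (hk : k ≠ 0) :
    0 < 1 - Real.cos (modeAngle k) := by
  obtain ⟨i, hi⟩ := Function.ne_iff.1 hk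
  have hd' : (0 : ℝ) < d := by exact_mod_cast hd
  have hn : (0 : ℝ) < n := by exact_mod_cast NeZero.pos n
  refine lt_of_lt_of_le ?_ (le_one_sub_cos_modeAngle hd k i)
  have : ((k i).valMinAbs : ℝ) ≠ 0 := by
    simpa using hi
  positivity

lemma card_natAbs_valMinAbs_le [NeZero n] (j : ℕ) :
    (Finset.univ.filter fun a : ZMod n => a.valMinAbs.natAbs ≤ j).card ≤ 2 * j + 1 := by
  have h : (Finset.univ.filter fun a : ZMod n => a.valMinAbs.natAbs ≤ j).card ≤
      (Finset.Icc (-(j : ℤ)) j).card := by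
    refine Finset.card_le_card_of_injOn ZMod.valMinAbs ?_
      (fun a _ b _ hab => ZMod.valMinAbs_inj.1 hab)
    intro a ha
    simp at ha ⊢
    omega
  refine h.trans (le_of_eq ?_)
  simp
  omega

lemma card_dominated_le [NeZero n] (i : Fin d) (a : ZMod n) :
    (Finset.univ.filter fun k : Vertex d n =>
      k i = a ∧ ∀ l, (k l).valMinAbs.natAbs ≤ a.valMinAbs.natAbs).card ≤
      (2 * a.valMinAbs.natAbs + 1) ^ (d - 1) := by
  classical
  have hsub : (Finset.univ.filter fun k : Vertex d n =>
      k i = a ∧ ∀ l, (k l).valMinAbs.natAbs ≤ a.valMinAbs.natAbs) ⊆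
      Fintype.piFinset fun l => if l = i then {a} else
        Finset.univ.filter fun b : ZMod n => b.valMinAbs.natAbs ≤ a.valMinAbs.natAbs := by
    intro k hk
    simp only [Finset.mem_filter, Finset.mem_univ, true_and] at hk
    rw [Fintype.mem_piFinset]
    intro l
    split_ifs with h
    · simp [h, hk.1]
    · simpa using hk.2 l
  refine (Finset.card_le_card hsub).trans ?_
  rw [Fintype.card_piFinset, ← Finset.mul_prod_erase _ _ (Finset.mem_univ i)]
  simp only [if_true, Finset.card_singleton, one_mul]
  refine (Finset.prod_le_pow_card _ _ (2 * a.valMinAbs.natAbs + 1) fun l hl => ?_).trans ?_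
  · rw [if_neg (Finset.ne_of_mem_erase hl)]
    exact card_natAbs_valMinAbs_le _
  · simp

/-- Each nonzero mode is charged to a coordinate of largest absolute value. -/
lemma inv_one_sub_cos_modeAngle_le [NeZero n] (hd : 0 < d) {k : Vertex d n} (hk : k ≠ 0) :
    1 / (1 - Real.cos (modeAngle k)) ≤
      ∑ i, ∑ a : ZMod n with a ≠ 0,
        if k i = a ∧ ∀ l, (k l).valMinAbs.natAbs ≤ a.valMinAbs.natAbs
          then (d * n ^ 2 / 8 : ℝ) / (a.valMinAbs.natAbs : ℝ) ^ 2 else 0 := by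
  have : Nonempty (Fin d) := ⟨⟨0, hd⟩⟩
  obtain ⟨i, -, hi⟩ := Finset.exists_max_image Finset.univ
    (fun i => (k i).valMinAbs.natAbs) Finset.univ_nonempty
  have hki : k i ≠ 0 := by
    intro h0
    refine hk (funext fun l => ?_)
    have := hi l (Finset.mem_univ _)
    simpa [h0] using this
  have hm : ((k i).valMinAbs : ℝ) ≠ 0 := by simpa using hki
  have hd' : (0 : ℝ) < d := by exact_mod_cast hd
  have hn : (0 : ℝ) < n := by exact_mod_cast NeZero.pos n
  have h1 : 1 / (1 - Real.cos (modeAngle k)) ≤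
      (d * n ^ 2 / 8 : ℝ) / ((k i).valMinAbs.natAbs : ℝ) ^ 2 := by
    rw [Nat.cast_natAbs, Int.cast_abs, sq_abs]
    refine (one_div_le_one_div_of_le (by positivity)
      (le_one_sub_cos_modeAngle hd k i)).trans (le_of_eq ?_)
    field_simp
  refine h1.trans ?_
  refine le_trans ?_ (Finset.single_le_sum (f := fun i => ∑ a : ZMod n with a ≠ 0,
        if k i = a ∧ ∀ l, (k l).valMinAbs.natAbs ≤ a.valMinAbs.natAbs
          then (d * n ^ 2 / 8 : ℝ) / (a.valMinAbs.natAbs : ℝ) ^ 2 else 0)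
    (fun i _ => Finset.sum_nonneg fun a _ => ?_) (Finset.mem_univ i))
  · refine le_trans ?_ (Finset.single_le_sum (f := fun a =>
        if k i = a ∧ ∀ l, (k l).valMinAbs.natAbs ≤ a.valMinAbs.natAbs
          then (d * n ^ 2 / 8 : ℝ) / (a.valMinAbs.natAbs : ℝ) ^ 2 else 0)
      (fun a _ => ?_) (a := k i) (by simp [hki]))
    · rw [if_pos ⟨rfl, fun l => hi l (Finset.mem_univ _)⟩]
    · split_ifs <;> positivity
  · split_ifs <;> positivity

/-- After charging each mode to a dominant coordinate `i` with value `a`, every pair `(i, a)` costs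
at most a constant times `n ^ (d - 1)`, and there are at most `d * n` pairs. -/
lemma sum_inv_one_sub_cos_le [NeZero n] (hd : 3 ≤ d) :
    ∑ k : Vertex d n with k ≠ 0, 1 / (1 - Real.cos (modeAngle k)) ≤
      (d ^ 2 * 3 ^ (d - 1) / 8 : ℝ) * (n : ℝ) ^ d := by
  have hn : (0 : ℝ) < n := by exact_mod_cast NeZero.pos n
  have hterm (i : Fin d) (a : ZMod n) (ha : a ≠ 0) :
      (∑ k : Vertex d n, if k i = a ∧ ∀ l, (k l).valMinAbs.natAbs ≤ a.valMinAbs.natAbs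
          then (d * n ^ 2 / 8 : ℝ) / (a.valMinAbs.natAbs : ℝ) ^ 2 else 0) ≤
        (d * 3 ^ (d - 1) / 8 : ℝ) * (n : ℝ) ^ (d - 1) := by
    rw [← Finset.sum_filter, Finset.sum_const, nsmul_eq_mul]
    set m := a.valMinAbs.natAbs with hm
    have hm1 : 1 ≤ m := by
      rw [Nat.one_le_iff_ne_zero, hm]
      simpa using ha
    have hmn : m ≤ n := (a.natAbs_valMinAbs_le).trans (Nat.div_le_self _ _)
    have hm1' : (1 : ℝ) ≤ m := by exact_mod_cast hm1
    have hmn' : (m : ℝ) ≤ n := by exact_mod_cast hmn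
    have hc : ((Finset.univ.filter fun k : Vertex d n =>
        k i = a ∧ ∀ l, (k l).valMinAbs.natAbs ≤ m).card : ℝ) ≤ (3 * m) ^ (d - 1) := by
      have h1 : ((Finset.univ.filter fun k : Vertex d n =>
          k i = a ∧ ∀ l, (k l).valMinAbs.natAbs ≤ m).card : ℝ) ≤ (2 * m + 1) ^ (d - 1) := by
        exact_mod_cast card_dominated_le i a
      refine h1.trans (pow_le_pow_left₀ (by positivity) (by linarith) _)
    refine (mul_le_mul_of_nonneg_right hc (by positivity)).trans ?_
    -- Here `c = d - 3`: the count `m ^ (d - 1)` absorbs the denominator `m²`, leaving a nonnegative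
    -- power `m ^ c ≤ n ^ c`. In lower dimension this exponent would be negative.
    obtain ⟨c, rfl⟩ := Nat.exists_eq_add_of_le' hd
    have e : ((3 * (m : ℝ)) ^ (c + 3 - 1)) * (((c + 3 : ℕ) * (n : ℝ) ^ 2 / 8) / (m : ℝ) ^ 2) =
        ((c + 3 : ℕ) * 3 ^ (c + 2) / 8 : ℝ) * ((m : ℝ) ^ c * n ^ 2) := by
      rw [show c + 3 - 1 = c + 2 from rfl]
      field_simp
      ring
    rw [e, show c + 3 - 1 = c + 2 from rfl, pow_add (n : ℝ)]
    gcongr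
  calc ∑ k : Vertex d n with k ≠ 0, 1 / (1 - Real.cos (modeAngle k))
      ≤ ∑ k : Vertex d n with k ≠ 0, ∑ i, ∑ a : ZMod n with a ≠ 0,
        (if k i = a ∧ ∀ l, (k l).valMinAbs.natAbs ≤ a.valMinAbs.natAbs
          then (d * n ^ 2 / 8 : ℝ) / (a.valMinAbs.natAbs : ℝ) ^ 2 else 0) :=
        Finset.sum_le_sum fun k hk =>
          inv_one_sub_cos_modeAngle_le (by omega) (Finset.mem_filter.1 hk).2
    _ ≤ ∑ k : Vertex d n, ∑ i, ∑ a : ZMod n with a ≠ 0,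
        (if k i = a ∧ ∀ l, (k l).valMinAbs.natAbs ≤ a.valMinAbs.natAbs
          then (d * n ^ 2 / 8 : ℝ) / (a.valMinAbs.natAbs : ℝ) ^ 2 else 0) := by
        refine Finset.sum_le_sum_of_subset_of_nonneg (Finset.filter_subset _ _) fun k _ _ => ?_
        refine Finset.sum_nonneg fun i _ => Finset.sum_nonneg fun a _ => ?_
        split_ifs <;> positivity
    _ = ∑ i : Fin d, ∑ a : ZMod n with a ≠ 0, ∑ k : Vertex d n,
        (if k i = a ∧ ∀ l, (k l).valMinAbs.natAbs ≤ a.valMinAbs.natAbs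
          then (d * n ^ 2 / 8 : ℝ) / (a.valMinAbs.natAbs : ℝ) ^ 2 else 0) := by
        rw [Finset.sum_comm]
        exact Finset.sum_congr rfl fun i _ => Finset.sum_comm
    _ ≤ ∑ i : Fin d, ∑ a : ZMod n with a ≠ 0, (d * 3 ^ (d - 1) / 8 : ℝ) * (n : ℝ) ^ (d - 1) :=
        Finset.sum_le_sum fun i _ => Finset.sum_le_sum fun a ha =>
          hterm i a (Finset.mem_filter.1 ha).2
    _ ≤ ∑ i : Fin d, ∑ a : ZMod n, (d * 3 ^ (d - 1) / 8 : ℝ) * (n : ℝ) ^ (d - 1) :=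
        Finset.sum_le_sum fun i _ =>
          Finset.sum_le_sum_of_subset_of_nonneg (Finset.filter_subset _ _) fun a _ _ => by positivity
    _ = (d ^ 2 * 3 ^ (d - 1) / 8 : ℝ) * (n : ℝ) ^ d := by
        obtain ⟨c, rfl⟩ := Nat.exists_eq_add_of_le' hd
        simp [ZMod.card]
        ring

lemma card_vertex [NeZero n] : Fintype.card (Vertex d n) = n ^ d := by
  simp [ZMod.card]

/-- Each term is at least `1 / 2`, and there are `N - 1 ≥ N / 2` of them. -/
lemma le_sum_inv_one_sub_cos [NeZero n] (hd : 3 ≤ d) (hn : 2 ≤ n) :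
    (1 / 4 : ℝ) * (n : ℝ) ^ d ≤
      ∑ k : Vertex d n with k ≠ 0, 1 / (1 - Real.cos (modeAngle k)) := by
  have h : ∑ k : Vertex d n with k ≠ 0, (1 / 2 : ℝ) ≤
      ∑ k : Vertex d n with k ≠ 0, 1 / (1 - Real.cos (modeAngle k)) :=
    Finset.sum_le_sum fun k hk => one_div_le_one_div_of_le
      (one_sub_cos_modeAngle_pos (by omega) (Finset.mem_filter.1 hk).2)
      (by linarith [Real.neg_one_le_cos (modeAngle k)])
  refine le_trans ?_ h
  have hN : 2 ≤ n ^ d := hn.trans (Nat.le_self_pow (by omega) n)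
  have hN' : (2 : ℝ) ≤ (n : ℝ) ^ d := by exact_mod_cast hN
  rw [Finset.sum_const, Finset.filter_ne', Finset.card_erase_of_mem (Finset.mem_univ _),
    Finset.card_univ, card_vertex, nsmul_eq_mul, Nat.cast_sub (by omega)]
  push_cast
  linarith

/-! ### Random walk, Fourier analysis and the gap of the killed walk. -/

/-- The simple random walk operator of the torus. -/
noncomputable def srw {K : Type*} [DivisionRing K] (f : Vertex d n → K) (x : Vertex d n) : K :=
  (∑ e : Direction d, f (neighbor e x)) / (2 * d)

lemma flipFlop_involutive : Function.Involutive (flipFlop : Label d n → Label d n) := by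
  rintro ⟨⟨i, s⟩, x⟩
  cases s <;> simp [flipFlop, neighbor]

/-- Moving along a direction, as a permutation of the vertices. -/
def neighborEquiv (e : Direction d) : Vertex d n ≃ Vertex d n where
  toFun := neighbor e
  invFun := neighbor (e.1, !e.2)
  left_inv x := by rcases e with ⟨i, s⟩; cases s <;> simp [neighbor]
  right_inv x := by rcases e with ⟨i, s⟩; cases s <;> simp [neighbor]

lemma sum_neighbor [NeZero n] {M : Type*} [AddCommMonoid M] (e : Direction d)
    (f : Vertex d n → M) : ∑ x, f (neighbor e x) = ∑ x, f x :=
  Equiv.sum_comp (neighborEquiv e) f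

lemma sum_srw [NeZero n] (hd : 0 < d) (f : Vertex d n → ℝ) : ∑ x, srw f x = ∑ x, f x := by
  have hd' : (d : ℝ) ≠ 0 := by exact_mod_cast hd.ne'
  simp only [srw]
  rw [← Finset.sum_div, Finset.sum_comm]
  simp only [sum_neighbor]
  simp
  field_simp

/-- The Fourier mode of the torus with momentum `k`. -/
noncomputable def mode [NeZero n] (k x : Vertex d n) : ℂ := ∏ i, ZMod.stdAddChar (x i * k i)

lemma mode_add [NeZero n] (k x y : Vertex d n) : mode k (x + y) = mode k x * mode k y := by
  simp [mode, add_mul, AddChar.map_add_eq_mul, Finset.prod_mul_distrib]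

lemma mode_neg [NeZero n] (k x : Vertex d n) : mode k (-x) = star (mode k x) := by
  simp [mode, AddChar.map_neg_eq_conj]

lemma sum_mode [NeZero n] (x : Vertex d n) :
    ∑ k : Vertex d n, mode k x = if x = 0 then (n : ℂ) ^ d else 0 := by
  classical
  have h : ∑ k : Vertex d n, mode k x = ∏ i, ∑ a : ZMod n, ZMod.stdAddChar (x i * a) := by
    rw [Finset.prod_univ_sum, Fintype.piFinset_univ]
    rfl
  rw [h]
  have h2 (i : Fin d) : ∑ a : ZMod n, (ZMod.stdAddChar (x i * a) : ℂ) =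
      if x i = 0 then (n : ℂ) else 0 := by
    simp only [mul_comm (x i)]
    rw [AddChar.sum_mulShift _ (ZMod.isPrimitive_stdAddChar n)]
    split_ifs <;> simp [ZMod.card]
  simp only [h2]
  split_ifs with hx
  · simp [hx]
  · obtain ⟨i, hi⟩ := Function.ne_iff.1 hx
    exact Finset.prod_eq_zero (Finset.mem_univ i) (if_neg hi)

/-- The (unnormalised) discrete Fourier transform on the torus. -/
noncomputable def torusDFT [NeZero n] (f : Vertex d n → ℂ) (k : Vertex d n) : ℂ :=
  ∑ x, f x * mode k x

lemma sum_torusDFT [NeZero n] (f : Vertex d n → ℂ) :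
    ∑ k, torusDFT f k = (n : ℂ) ^ d * f 0 := by
  simp only [torusDFT]
  rw [Finset.sum_comm]
  simp only [← Finset.mul_sum, sum_mode]
  simp [mul_comm]

lemma sum_star_torusDFT_mul [NeZero n] (f g : Vertex d n → ℂ) :
    ∑ k, star (torusDFT f k) * torusDFT g k = (n : ℂ) ^ d * ∑ x, star (f x) * g x := by
  have h (k : Vertex d n) : star (torusDFT f k) * torusDFT g k =
      ∑ x, ∑ y, star (f x) * g y * mode k (y - x) := by
    simp only [torusDFT, star_sum, Finset.sum_mul_sum]
    refine Finset.sum_congr rfl fun x _ => Finset.sum_congr rfl fun y _ => ?_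
    rw [sub_eq_add_neg, mode_add, mode_neg, star_mul']
    ring
  simp only [h]
  rw [Finset.sum_comm, Finset.mul_sum]
  refine Finset.sum_congr rfl fun x _ => ?_
  rw [Finset.sum_comm]
  simp only [← Finset.mul_sum, sum_mode, sub_eq_zero]
  simp [mul_comm]

lemma stdAddChar_add_neg [NeZero n] (a : ZMod n) :
    (ZMod.stdAddChar a + ZMod.stdAddChar (-a) : ℂ) =
      2 * (Real.cos (2 * Real.pi * (a.val : ℝ) / n) : ℝ) := by
  rw [AddChar.map_neg_eq_conj, Complex.add_conj, ZMod.stdAddChar_apply, ZMod.toCircle_apply]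
  rw [show (2 * Real.pi * Complex.I * a.val / n : ℂ) =
    ((2 * Real.pi * (a.val : ℝ) / n : ℝ) : ℂ) * Complex.I by push_cast; ring]
  rw [Complex.exp_ofReal_mul_I_re]
  push_cast
  ring

lemma mode_single [NeZero n] (k : Vertex d n) (i : Fin d) (a : ZMod n) :
    mode k (Pi.single i a) = ZMod.stdAddChar (a * k i) := by
  rw [mode, Finset.prod_eq_single i]
  · simp
  · intro j _ hj
    simp [hj]
  · simp

lemma sum_mode_neighbor [NeZero n] (hd : 0 < d) (k x : Vertex d n) :
    ∑ e : Direction d, mode k (neighbor e x) =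
      2 * d * (Real.cos (modeAngle k) : ℝ) * mode k x := by
  have hd' : (d : ℂ) ≠ 0 := by exact_mod_cast hd.ne'
  have h : ∑ e : Direction d, mode k (neighbor e x) =
      ∑ i, (ZMod.stdAddChar (k i) + ZMod.stdAddChar (-(k i)) : ℂ) * mode k x := by
    rw [Fintype.sum_prod_type]
    refine Finset.sum_congr rfl fun i _ => ?_
    have h1 : mode k (neighbor (i, true) x) = mode k x * ZMod.stdAddChar (k i) := by
      simp [neighbor, mode_add, mode_single]
    have h2 : mode k (neighbor (i, false) x) = mode k x * ZMod.stdAddChar (-(k i)) := by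
      simp [neighbor, sub_eq_add_neg, mode_add, ← Pi.single_neg, mode_single]
    rw [Fintype.sum_bool, h1, h2]
    ring
  rw [h, ← Finset.sum_mul, cos_modeAngle]
  simp only [stdAddChar_add_neg]
  rw [← Finset.mul_sum]
  push_cast
  field_simp

/-- The walk is symmetric: translating the sum and reversing directions moves `srw` onto the mode,
which is an eigenfunction. -/
lemma torusDFT_srw [NeZero n] (hd : 0 < d) (f : Vertex d n → ℂ) (k : Vertex d n) :
    torusDFT (srw f) k = (Real.cos (modeAngle k) : ℝ) * torusDFT f k := by
  have hd' : (d : ℂ) ≠ 0 := by exact_mod_cast hd.ne'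
  have h1 : ∑ x, (∑ e : Direction d, f (neighbor e x)) * mode k x =
      ∑ x, f x * ∑ e : Direction d, mode k (neighbor e x) := by
    simp only [Finset.sum_mul, Finset.mul_sum]
    rw [Finset.sum_comm, Finset.sum_comm (s := Finset.univ (α := Vertex d n)),
      ← Equiv.sum_comp (Equiv.prodCongr (Equiv.refl (Fin d)) Equiv.boolNot)]
    refine Finset.sum_congr rfl fun e _ => ?_
    rw [← Equiv.sum_comp (neighborEquiv (n := n) e)]
    refine Finset.sum_congr rfl fun x _ => ?_
    have := (neighborEquiv (n := n) e).left_inv x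
    rcases e with ⟨i, s⟩
    cases s <;> simp_all [neighborEquiv, neighbor]
  simp only [torusDFT, srw, div_mul_eq_mul_div]
  rw [← Finset.sum_div, h1]
  simp only [sum_mode_neighbor hd]
  rw [Finset.mul_sum, Finset.sum_div]
  refine Finset.sum_congr rfl fun x _ => ?_
  field_simp

/-- The Dirichlet spectral gap of the torus with the vertex `0` removed. -/
lemma dirichlet_gap [NeZero n] (hd : 0 < d) {b : ℝ}
    (hb : ∑ k : Vertex d n with k ≠ 0, 1 / (1 - Real.cos (modeAngle k)) ≤ b * (n : ℝ) ^ d)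
    (f : Vertex d n → ℝ) (hf : f 0 = 0) :
    ∑ x, f x ^ 2 ≤ 2 * (b * (n : ℝ) ^ d) * ∑ x, f x * (f x - srw f x) := by
  set F : Vertex d n → ℝ := fun k => ‖torusDFT (fun x => (f x : ℂ)) k‖ with hF
  have hn : (0 : ℝ) < n := by exact_mod_cast NeZero.pos n
  have hN : (0 : ℝ) < (n : ℝ) ^ d := by positivity
  have hParseval : ∑ k, F k ^ 2 = (n : ℝ) ^ d * ∑ x, f x ^ 2 := by
    have := sum_star_torusDFT_mul (fun x => (f x : ℂ)) (fun x => (f x : ℂ))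
    simp only [Complex.star_def, Complex.conj_mul', Complex.conj_ofReal] at this
    have h2 : ((∑ k, F k ^ 2 : ℝ) : ℂ) = (((n : ℝ) ^ d * ∑ x, f x ^ 2 : ℝ) : ℂ) := by
      push_cast
      rw [hF, this]
      simp only [sq]
    exact_mod_cast h2
  have hEnergy : ∑ k, (1 - Real.cos (modeAngle k)) * F k ^ 2 =
      (n : ℝ) ^ d * ∑ x, f x * (f x - srw f x) := by
    have hs : srw (fun x => (f x : ℂ)) = fun x => ((srw f x : ℝ) : ℂ) := by
      funext x
      simp [srw]
    have := sum_star_torusDFT_mul (fun x => (f x : ℂ)) (srw (fun x => (f x : ℂ)))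
    simp only [torusDFT_srw hd, Complex.star_def, mul_left_comm (starRingEnd ℂ _), Complex.conj_mul',
      Complex.conj_ofReal] at this
    simp only [hs] at this
    have h2 : ∑ k, Real.cos (modeAngle k) * F k ^ 2 = (n : ℝ) ^ d * ∑ x, f x * srw f x := by
      rw [hF]
      exact_mod_cast this
    simp only [sub_mul, one_mul, mul_sub (f _), Finset.sum_sub_distrib]
    rw [h2, hParseval]
    simp only [sq]
    ring
  -- Fourier inversion at `0` turns `f 0 = 0` into the vanishing of the sum of all coefficients.
  have hzero : F 0 ≤ ∑ k : Vertex d n with k ≠ 0, F k := by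
    have := sum_torusDFT (fun x => (f x : ℂ))
    rw [hf, Complex.ofReal_zero, mul_zero, ← Finset.add_sum_erase _ _ (Finset.mem_univ 0)] at this
    rw [Finset.filter_ne']
    simp only [hF]
    rw [eq_neg_of_add_eq_zero_left this, norm_neg]
    exact norm_sum_le _ _
  have hsplit (G : Vertex d n → ℝ) : ∑ k, G k = G 0 + ∑ k : Vertex d n with k ≠ 0, G k := by
    rw [Finset.filter_ne', Finset.add_sum_erase _ _ (Finset.mem_univ 0)]
  have hcos0 : Real.cos (modeAngle (0 : Vertex d n)) = 1 := by
    have hd' : (d : ℝ) ≠ 0 := by exact_mod_cast hd.ne'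
    rw [cos_modeAngle]
    simp [hd']
  set E := ∑ k : Vertex d n with k ≠ 0, (1 - Real.cos (modeAngle k)) * F k ^ 2 with hE
  have hEe : E = (n : ℝ) ^ d * ∑ x, f x * (f x - srw f x) := by
    rw [← hEnergy, hsplit, hcos0]
    simp [hE]
  set R := ∑ k : Vertex d n with k ≠ 0, 1 / (1 - Real.cos (modeAngle k)) with hR
  have hpos (k : Vertex d n) (hk : k ∈ Finset.univ.filter (fun k : Vertex d n => k ≠ 0)) :
      0 < 1 - Real.cos (modeAngle k) := one_sub_cos_modeAngle_pos hd (Finset.mem_filter.1 hk).2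
  have hE0 : 0 ≤ E := Finset.sum_nonneg fun k hk => mul_nonneg (hpos k hk).le (sq_nonneg _)
  have hCS : (∑ k : Vertex d n with k ≠ 0, F k) ^ 2 ≤ R * E := by
    refine Finset.sum_sq_le_sum_mul_sum_of_sq_le_mul _ (fun k hk => ?_) (fun k hk => ?_)
      (fun k hk => ?_)
    · exact (one_div_pos.2 (hpos k hk)).le
    · exact mul_nonneg (hpos k hk).le (sq_nonneg _)
    · have := (hpos k hk).ne'
      field_simp
      rfl
  have hrest : ∑ k : Vertex d n with k ≠ 0, F k ^ 2 ≤ R * E := by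
    rw [hE, Finset.mul_sum]
    refine Finset.sum_le_sum fun k hk => ?_
    have h1 : 1 / (1 - Real.cos (modeAngle k)) ≤ R :=
      Finset.single_le_sum (f := fun k => 1 / (1 - Real.cos (modeAngle k)))
        (fun k hk => (one_div_pos.2 (hpos k hk)).le) hk
    rw [div_le_iff₀ (hpos k hk)] at h1
    nlinarith [sq_nonneg (F k)]
  have hF0 : F 0 ^ 2 ≤ R * E :=
    (pow_le_pow_left₀ (norm_nonneg _) hzero 2).trans hCS
  -- The factor 2 arises because the zero mode and the nonzero modes together are each bounded by `R
  -- * E`.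
  have htot : (n : ℝ) ^ d * ∑ x, f x ^ 2 ≤ 2 * (b * (n : ℝ) ^ d) * E := by
    rw [← hParseval, hsplit]
    nlinarith [mul_le_mul_of_nonneg_right hb hE0]
  rw [hEe] at htot
  refine le_of_mul_le_mul_left (htot.trans (le_of_eq ?_)) hN
  ring

/-! ### Reduction to real amplitudes and to the marked vertex `0`. -/

/-- One step of the perturbed walk on real amplitudes. -/
noncomputable def realStep (v : Vertex d n) : (Label d n → ℝ) →ₗ[ℝ] (Label d n → ℝ) where
  toFun ψ b := if (flipFlop b).2 = v then -ψ (flipFlop b)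
    else (∑ e, ψ (e, (flipFlop b).2)) / d - ψ (flipFlop b)
  map_add' ψ φ := by
    funext b
    simp only [Pi.add_apply, Finset.sum_add_distrib]
    split_ifs <;> ring
  map_smul' c ψ := by
    funext b
    simp only [Pi.smul_apply, smul_eq_mul, ← Finset.mul_sum, RingHom.id_apply]
    split_ifs <;> ring

lemma realStep_apply (v : Vertex d n) (ψ : Label d n → ℝ) (b : Label d n) :
    realStep v ψ b = if (flipFlop b).2 = v then -ψ (flipFlop b)
      else (∑ e, ψ (e, (flipFlop b).2)) / d - ψ (flipFlop b) := rfl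

lemma shift_mulVec [NeZero n] (φ : Label d n → ℂ) (b : Label d n) :
    (shift d n *ᵥ φ) b = φ (flipFlop b) := by
  simp only [Matrix.mulVec, dotProduct, shift, Matrix.of_apply]
  simp only [← flipFlop_involutive.eq_iff (x := b)]
  simp

lemma coinFlip_apply (hd : 0 < d) (e e' : Direction d) :
    coinFlip d e e' = 1 / d - if e = e' then 1 else 0 := by
  have hd' : (d : ℂ) ≠ 0 := by exact_mod_cast hd.ne'
  have h : ((√(2 * d : ℝ) : ℝ) : ℂ) * (√(2 * d : ℝ) : ℝ) = 2 * d := by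
    rw [← Complex.ofReal_mul, Real.mul_self_sqrt (by positivity)]
    push_cast
    rfl
  have h2 : (coinUniform d e) * star (coinUniform d e') = 1 / (2 * d) := by
    simp only [coinUniform, Complex.star_def, map_div₀, map_one, Complex.conj_ofReal]
    rw [div_mul_div_comm, h, one_mul]
  simp only [coinFlip, Matrix.sub_apply, Matrix.smul_apply, Matrix.vecMulVec_apply, Pi.star_apply,
    h2, Matrix.one_apply, smul_eq_mul]
  congr 1
  field_simp

lemma perturbedCoin_mulVec [NeZero n] (hd : 0 < d) (v : Vertex d n) (φ : Label d n → ℂ)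
    (b : Label d n) :
    (perturbedCoin v *ᵥ φ) b =
      if b.2 = v then -φ b else (∑ e, φ (e, b.2)) / d - φ b := by
  obtain ⟨e, x⟩ := b
  have hentry (e' : Direction d) (x' : Vertex d n) : perturbedCoin v (e, x) (e', x') =
      if x = x' then (if x = v then (if e = e' then (-1 : ℂ) else 0)
        else 1 / (d : ℂ) - if e = e' then 1 else 0) else 0 := by
    simp only [perturbedCoin, vertexProj, markingCoin, Matrix.add_apply, Matrix.kroneckerMap_apply,
      Matrix.sub_apply, Matrix.neg_apply, Matrix.one_apply, Matrix.single_apply,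
      coinFlip_apply hd]
    by_cases h1 : x = x' <;> by_cases h2 : x = v <;> by_cases h3 : e = e' <;>
      simp_all [eq_comm]
  simp only [Matrix.mulVec, dotProduct]
  rw [Fintype.sum_prod_type]
  simp only [hentry, ite_mul, zero_mul, Finset.sum_ite_eq, Finset.mem_univ, if_true]
  split_ifs with h
  · simp
  · simp [sub_mul, Finset.sum_sub_distrib, ← Finset.mul_sum, div_eq_inv_mul]

lemma walkStep_mulVec_ofReal [NeZero n] (hd : 0 < d) (v : Vertex d n) (ψ : Label d n → ℝ) (c : ℂ) :
    walkStep v *ᵥ (fun b => (ψ b : ℂ) * c) = fun b => (realStep v ψ b : ℂ) * c := by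
  funext b
  rw [walkStep, ← Matrix.mulVec_mulVec, shift_mulVec, perturbedCoin_mulVec hd, realStep_apply]
  split_ifs
  · push_cast
    ring
  · push_cast
    rw [← Finset.sum_mul]
    ring

/-- The walk matrix is real, so the evolution can be run on the all-ones vector, with the
normalisation kept as a scalar. -/
lemma stateAfter_eq [NeZero n] (hd : 0 < d) (v : Vertex d n) (t : ℕ) :
    stateAfter v t = fun b => (((realStep v ^ t) 1 b : ℝ) : ℂ) *
      ((1 / √(2 * d * (n : ℝ) ^ d) : ℝ) : ℂ) := by
  induction t with
  | zero =>
    funext b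
    simp [stateAfter, initialState]
  | succ t ih =>
    rw [stateAfter, pow_succ', ← Matrix.mulVec_mulVec, ← stateAfter, ih,
      walkStep_mulVec_ofReal hd, pow_succ', Module.End.mul_apply]

lemma successProb_eq [NeZero n] (hd : 0 < d) (v : Vertex d n) (t : ℕ) :
    successProb v t = (∑ e, ((realStep v ^ t) 1 (e, v)) ^ 2) / (2 * d * (n : ℝ) ^ d) := by
  rw [successProb, Finset.sum_div]
  refine Finset.sum_congr rfl fun e _ => ?_
  simp only [stateAfter_eq hd]
  rw [← Complex.ofReal_mul, Complex.norm_real, Real.norm_eq_abs, sq_abs, mul_pow,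
    div_pow, Real.sq_sqrt (by positivity)]
  ring

lemma flipFlop_translate (e : Direction d) (x v : Vertex d n) :
    flipFlop (e, x + v) = ((flipFlop (e, x)).1, (flipFlop (e, x)).2 + v) := by
  rcases e with ⟨i, s⟩
  cases s <;> simp [flipFlop, neighbor] <;> abel

/-- Translation invariance is what allows one `T` to serve every marked vertex. -/
lemma realStep_pow_translate (v : Vertex d n) (t : ℕ) (e : Direction d) (x : Vertex d n) :
    (realStep v ^ t) 1 (e, x + v) = (realStep 0 ^ t) 1 (e, x) := by
  induction t generalizing e x with
  | zero => simp
  | succ t ih =>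
    simp only [pow_succ', Module.End.mul_apply, realStep_apply, flipFlop_translate, ih,
      add_eq_right]

lemma successProb_eq_zero_vertex [NeZero n] (hd : 0 < d) (v : Vertex d n) (t : ℕ) :
    successProb v t =
      (∑ e, ((realStep (0 : Vertex d n) ^ t) 1 (e, 0)) ^ 2) / (2 * d * (n : ℝ) ^ d) := by
  rw [successProb_eq hd]
  congr 1
  refine Finset.sum_congr rfl fun e _ => ?_
  rw [← realStep_pow_translate v t e 0, zero_add]

lemma sum_label [NeZero n] (f : Label d n → ℝ) : ∑ b, f b = ∑ x, ∑ e, f (e, x) :=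
  Fintype.sum_prod_type_right f

/-- The Euclidean norm of a real amplitude vector. -/
noncomputable def ampNorm [NeZero n] (ψ : Label d n → ℝ) : ℝ :=
  ‖(WithLp.toLp 2 ψ : EuclideanSpace ℝ (Label d n))‖

lemma ampNorm_sq [NeZero n] (ψ : Label d n → ℝ) : ampNorm ψ ^ 2 = ∑ b, ψ b ^ 2 := by
  simp [ampNorm, EuclideanSpace.norm_sq_eq]

lemma ampNorm_nonneg [NeZero n] (ψ : Label d n → ℝ) : 0 ≤ ampNorm ψ := norm_nonneg _

lemma ampNorm_add_smul_le [NeZero n] (φ ψ : Label d n → ℝ) {r : ℝ} (hr : 0 ≤ r) :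
    ampNorm (φ + r • ψ) ≤ ampNorm φ + r * ampNorm ψ := by
  unfold ampNorm
  rw [WithLp.toLp_add, WithLp.toLp_smul]
  refine (norm_add_le _ _).trans ?_
  rw [norm_smul, Real.norm_of_nonneg hr]

/-- The shift permutes labels, and at each vertex the coin is either `-1` or the reflection in the
mean. -/
lemma ampNorm_realStep [NeZero n] (hd : 0 < d) (v : Vertex d n) (ψ : Label d n → ℝ) :
    ampNorm (realStep v ψ) = ampNorm ψ := by
  have hd' : (d : ℝ) ≠ 0 := by exact_mod_cast hd.ne'
  refine (pow_left_inj₀ (ampNorm_nonneg _) (ampNorm_nonneg _) two_ne_zero).1 ?_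
  rw [ampNorm_sq, ampNorm_sq]
  simp only [realStep_apply]
  refine (Equiv.sum_comp flipFlop_involutive.toPerm (fun b : Label d n =>
    (if b.2 = v then -ψ b else (∑ e, ψ (e, b.2)) / d - ψ b) ^ 2)).trans ?_
  rw [sum_label, sum_label]
  refine Finset.sum_congr rfl fun x _ => ?_
  by_cases hx : x = v
  · simp [hx]
  · simp only [if_neg hx, sub_sq, Finset.sum_add_distrib, Finset.sum_sub_distrib]
    rw [← Finset.mul_sum]
    simp
    field_simp
    ring

lemma ampNorm_realStep_pow [NeZero n] (hd : 0 < d) (v : Vertex d n) (t : ℕ) (ψ : Label d n → ℝ) :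
    ampNorm ((realStep v ^ t) ψ) = ampNorm ψ := by
  induction t with
  | zero => simp
  | succ t ih => rw [pow_succ', Module.End.mul_apply, ampNorm_realStep hd, ih]

/-- The mean amplitude over the coin register at the vertex `0`. -/
noncomputable def meanAtZero : (Label d n → ℝ) →ₗ[ℝ] ℝ where
  toFun ψ := (∑ e, ψ (e, 0)) / (2 * d)
  map_add' ψ φ := by simp [Finset.sum_add_distrib, add_div]
  map_smul' c ψ := by simp [← Finset.mul_sum, mul_div_assoc]

lemma meanAtZero_apply (ψ : Label d n → ℝ) : meanAtZero ψ = (∑ e, ψ (e, 0)) / (2 * d) := rfl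

lemma meanAtZero_sq_le (hd : 0 < d) (ψ : Label d n → ℝ) :
    meanAtZero ψ ^ 2 ≤ (∑ e, ψ (e, 0) ^ 2) / (2 * d) := by
  have hd' : (0 : ℝ) < d := by exact_mod_cast hd
  have := sq_sum_le_card_mul_sum_sq (s := Finset.univ) (f := fun e : Direction d => ψ (e, 0))
  rw [meanAtZero_apply, div_pow, div_le_div_iff₀ (by positivity) (by positivity)]
  simp [Direction] at this
  nlinarith

lemma abs_meanAtZero_le [NeZero n] (hd : 0 < d) (ψ : Label d n → ℝ) :
    |meanAtZero ψ| ≤ ampNorm ψ / √(2 * d) := by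
  refine abs_le_of_sq_le_sq ?_ (div_nonneg (ampNorm_nonneg _) (Real.sqrt_nonneg _))
  rw [div_pow, Real.sq_sqrt (by positivity), ampNorm_sq]
  refine (meanAtZero_sq_le hd ψ).trans ?_
  gcongr
  rw [sum_label]
  exact Finset.single_le_sum (f := fun x => ∑ e, ψ (e, x) ^ 2)
    (fun x _ => Finset.sum_nonneg fun e _ => sq_nonneg _) (Finset.mem_univ 0)

/-! ### Resolvent of the killed walk and the discounted sum. -/

/-- Solvability of the resolvent equation of the random walk killed at `0`. -/
lemma exists_resolvent [NeZero n] {ε : ℝ} (hε : 0 < ε)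
    (hE : ∀ f : Vertex d n → ℝ, f 0 = 0 → 0 ≤ ∑ x, f x * (f x - srw f x)) :
    ∃ h : Vertex d n → ℝ, h 0 = 0 ∧ ∀ x, x ≠ 0 → (1 + ε) * h x - srw h x = 1 := by
  classical
  let A : (Vertex d n → ℝ) →ₗ[ℝ] (Vertex d n → ℝ) :=
    { toFun := fun h x => if x = 0 then h 0 else (1 + ε) * h x - srw h x
      map_add' := fun f g => by
        funext x
        simp only [srw, Pi.add_apply, Finset.sum_add_distrib]
        split_ifs <;> ring
      map_smul' := fun c f => by
        funext x
        simp only [srw, Pi.smul_apply, smul_eq_mul, ← Finset.mul_sum, RingHom.id_apply]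
        split_ifs <;> ring }
  have hA (h : Vertex d n → ℝ) (x : Vertex d n) :
      A h x = if x = 0 then h 0 else (1 + ε) * h x - srw h x := rfl
  have hinj : Function.Injective A := by
    rw [injective_iff_map_eq_zero]
    intro h hh
    have h0 : h 0 = 0 := by simpa [hA] using congrFun hh 0
    have h1 (x : Vertex d n) : h x * (h x - srw h x) + ε * h x ^ 2 = 0 := by
      by_cases hx : x = 0
      · simp [hx, h0]
      · have := congrFun hh x
        rw [hA, if_neg hx, Pi.zero_apply] at this
        linear_combination h x * this
    have h2 : ∑ x, h x * (h x - srw h x) + ε * ∑ x, h x ^ 2 = 0 := by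
      rw [Finset.mul_sum, ← Finset.sum_add_distrib]
      exact Finset.sum_eq_zero fun x _ => h1 x
    have h3 : ∑ x, h x ^ 2 = 0 := by
      have h4 : 0 ≤ ∑ x, h x ^ 2 := Finset.sum_nonneg fun x _ => sq_nonneg _
      nlinarith [hE h h0]
    funext x
    have := (Finset.sum_eq_zero_iff_of_nonneg fun x _ => sq_nonneg (h x)).1 h3 x (Finset.mem_univ _)
    simpa using this
  obtain ⟨h, hh⟩ := LinearMap.injective_iff_surjective.1 hinj fun x => if x = 0 then 0 else 1
  refine ⟨h, by simpa [hA] using congrFun hh 0, fun x hx => ?_⟩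
  simpa [hA, hx] using congrFun hh x

/-- The indicator of the unmarked vertices, in the joint space. -/
def unmarked (d n : ℕ) : Label d n → ℝ := fun b => if b.2 = 0 then 0 else 1

lemma ampNorm_unmarked_le [NeZero n] :
    ampNorm (unmarked d n) ≤ √(2 * d) * √((n : ℝ) ^ d) := by
  rw [← Real.sqrt_mul (by positivity)]
  refine Real.le_sqrt_of_sq_le ?_
  rw [ampNorm_sq]
  have h : ∑ b : Label d n, unmarked d n b ^ 2 ≤ ∑ b : Label d n, (1 : ℝ) :=
    Finset.sum_le_sum fun b _ => by unfold unmarked; split_ifs <;> norm_num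
  refine h.trans (le_of_eq ?_)
  simp [ZMod.card, mul_comm]

/-- The discounted sum of the walk started from the unmarked vertices, with its mean amplitude at
the marked vertex. -/
lemma exists_discounted_sum [NeZero n] (hd : 0 < d) {r γ : ℝ} (hr0 : 0 < r) (hr1 : r < 1)
    (hγ : 0 < γ)
    (hgap : ∀ f : Vertex d n → ℝ, f 0 = 0 → γ * ∑ x, f x ^ 2 ≤ ∑ x, f x * (f x - srw f x)) :
    ∃ G : Label d n → ℝ, G - r • realStep 0 G = unmarked d n ∧
      ((n : ℝ) ^ d - 1) / 2 * (γ / (γ + (1 - r) ^ 2 / (2 * r))) ≤ meanAtZero G := by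
  have hd' : (0 : ℝ) < d := by exact_mod_cast hd
  have h1r : 0 < 1 - r := by linarith
  -- Chosen so that `2 r (1 + ε) = 1 + r²`, the coefficient of `h` left when the coin is eliminated
  -- from the equation for `G`.
  set ε := (1 - r) ^ 2 / (2 * r) with hε
  have hεpos : 0 < ε := by positivity
  have hεr : 2 * r * (1 + ε) = 1 + r ^ 2 := by
    rw [hε]
    field_simp
    ring
  obtain ⟨h, h0, heq⟩ := exists_resolvent hεpos fun f hf =>
    le_trans (mul_nonneg hγ.le (Finset.sum_nonneg fun x _ => sq_nonneg _)) (hgap f hf)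
  -- The ansatz is a vertex part `g x` plus half of `h` at the neighbour. Edges into `0` force `g x
  -- + r * h x / 2` to be the unmarked indicator at `x`; the other edges then require exactly the
  -- equation for `h`.
  set g : Vertex d n → ℝ := fun x => if x = 0 then 0 else 1 - r * (h x / 2) with hg
  refine ⟨fun b => g b.2 + h (neighbor b.1 b.2) / 2, ?_, ?_⟩
  · funext b
    have hinv : neighbor (flipFlop b).1 (flipFlop b).2 = b.2 := by
      have := congrArg Prod.snd (flipFlop_involutive b)
      simpa [flipFlop] using this
    have hs (x : Vertex d n) : ∑ e : Direction d, h (neighbor e x) = 2 * d * srw h x := by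
      rw [srw]
      field_simp
    have hy : (flipFlop b).2 = neighbor b.1 b.2 := rfl
    simp only [Pi.sub_apply, Pi.smul_apply, smul_eq_mul, realStep_apply, hinv,
      Finset.sum_add_distrib, ← Finset.sum_div, hs, unmarked]
    rw [hy]
    simp only [hg, Finset.sum_const, Finset.card_univ, Fintype.card_prod, Fintype.card_fin,
      Fintype.card_bool, nsmul_eq_mul]
    generalize neighbor b.1 b.2 = y
    generalize b.2 = x
    by_cases hx : x = 0 <;> by_cases hy : y = 0
    · simp [hx, hy, h0]
    · simp only [hx, hy, h0, if_true, if_false]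
      have := heq y hy
      push_cast
      field_simp
      linear_combination (2 * r) * this - h y * hεr
    · simp only [hx, hy, h0, if_true, if_false]
      ring
    · simp only [hx, hy, if_false]
      have := heq y hy
      push_cast
      field_simp
      linear_combination (2 * r) * this - h y * hεr
  · have hsumeq : ∑ x, (h x - srw h x) = 0 := by
      rw [Finset.sum_sub_distrib, sum_srw hd, sub_self]
    have hcard : ((Finset.univ.erase (0 : Vertex d n)).card : ℝ) = (n : ℝ) ^ d - 1 := by
      rw [Finset.card_erase_of_mem (Finset.mem_univ _), Finset.card_univ, card_vertex,
        Nat.cast_sub (Nat.one_le_pow _ _ (NeZero.pos n))]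
      push_cast
      rfl
    -- `h - srw h` has total sum zero, and off `0` it equals `1 - ε * h`, so the value at `0` is
    -- determined.
    have hsrw0 : srw h 0 = (n : ℝ) ^ d - 1 - ε * ∑ x, h x := by
      rw [← Finset.add_sum_erase _ _ (Finset.mem_univ 0), h0, zero_sub] at hsumeq
      rw [← Finset.add_sum_erase Finset.univ h (Finset.mem_univ 0), h0, zero_add]
      have h2 : ∑ x ∈ Finset.univ.erase (0 : Vertex d n), (h x - srw h x) =
          ∑ x ∈ Finset.univ.erase (0 : Vertex d n), (1 - ε * h x) :=
        Finset.sum_congr rfl fun x hx => by linarith [heq x (Finset.ne_of_mem_erase hx)]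
      rw [h2, Finset.sum_sub_distrib, Finset.sum_const, nsmul_eq_mul, mul_one, hcard,
        ← Finset.mul_sum] at hsumeq
      linarith
    have hmean : meanAtZero (fun b : Label d n => g b.2 + h (neighbor b.1 b.2) / 2) =
        srw h 0 / 2 := by
      rw [meanAtZero_apply, srw]
      simp only [hg, if_true, zero_add]
      rw [← Finset.sum_div]
      ring
    have hpair : ∑ x, h x = ∑ x, h x * (h x - srw h x) + ε * ∑ x, h x ^ 2 := by
      rw [Finset.mul_sum, ← Finset.sum_add_distrib]
      refine Finset.sum_congr rfl fun x _ => ?_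
      by_cases hx : x = 0
      · simp [hx, h0]
      · linear_combination (-h x) * heq x hx
    have hCS : (∑ x, h x) ^ 2 ≤ ((n : ℝ) ^ d - 1) * ∑ x, h x ^ 2 := by
      have := sq_sum_le_card_mul_sum_sq (s := Finset.univ.erase (0 : Vertex d n)) (f := h)
      rw [hcard] at this
      rw [← Finset.add_sum_erase Finset.univ h (Finset.mem_univ 0),
        ← Finset.add_sum_erase Finset.univ (fun x => h x ^ 2) (Finset.mem_univ 0), h0]
      simpa using this
    have hcard0 : (0 : ℝ) ≤ (n : ℝ) ^ d - 1 := by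
      rw [← hcard]
      positivity
    -- Pairing the equation with `h` and using the gap gives `∑ h ≥ (γ + ε) ∑ h²`; Cauchy–Schwarz
    -- bounds `(∑ h)²` by `(N - 1) ∑ h²`.
    have hsum_le : ∑ x, h x ≤ ((n : ℝ) ^ d - 1) / (γ + ε) := by
      rw [le_div_iff₀ (by positivity)]
      by_contra hcon
      have hgap' : (γ + ε) * ∑ x, h x ^ 2 ≤ ∑ x, h x := by linarith [hgap h h0]
      have hpos : 0 < ∑ x, h x := by
        by_contra hneg
        nlinarith
      nlinarith
    rw [hmean, hsrw0]
    have : ((n : ℝ) ^ d - 1) / 2 * (γ / (γ + ε)) =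
        ((n : ℝ) ^ d - 1 - ε * (((n : ℝ) ^ d - 1) / (γ + ε))) / 2 := by
      field_simp
      ring
    rw [this]
    gcongr

/-! ### Extracting a good time from the discounted sum. -/

lemma discounted_telescope (L : (Label d n → ℝ) →ₗ[ℝ] (Label d n → ℝ)) (r : ℝ)
    (G φ : Label d n → ℝ) (h : G - r • L G = φ) (T : ℕ) :
    ∑ t ∈ Finset.range T, r ^ t • (L ^ t) φ = G - r ^ T • (L ^ T) G := by
  induction T with
  | zero => simp
  | succ T ih =>
    rw [Finset.sum_range_succ, ih, ← h, map_sub, map_smul, pow_succ L, Module.End.mul_apply,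
      smul_sub, smul_smul, ← pow_succ]
    abel

/-- Within `T` steps some mean amplitude at the marked vertex is of order `√N`. -/
lemma exists_large_meanAtZero [NeZero n] (hd : 0 < d) {γ q : ℝ} (hγ : 0 < γ)
    (hN : 4 ≤ (n : ℝ) ^ d)
    (hgap : ∀ f : Vertex d n → ℝ, f 0 = 0 →
      γ / (n : ℝ) ^ d * ∑ x, f x ^ 2 ≤ ∑ x, f x * (f x - srw f x))
    (hq : 4 * q ≤ γ / (γ + 1)) (T : ℕ) (hT : (1 - 1 / √((n : ℝ) ^ d)) ^ T < q / 2) :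
    ∃ t < T, q / 2 * √((n : ℝ) ^ d) ≤
      |meanAtZero ((realStep (0 : Vertex d n) ^ t) (unmarked d n))| := by
  set N := (n : ℝ) ^ d with hNdef
  set s := √N with hs
  have hs2 : s * s = N := Real.mul_self_sqrt (by linarith)
  have hs_pos : 0 < s := Real.sqrt_pos.2 (by linarith)
  have hs_ge : 2 ≤ s := by
    by_contra hc
    nlinarith
  set r := 1 - 1 / s with hr
  have h1s : 1 / s ≤ 1 / 2 := one_div_le_one_div_of_le two_pos hs_ge
  have h1s' : 0 < 1 / s := one_div_pos.2 hs_pos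
  have hr0 : 1 / 2 ≤ r := by linarith
  have hr1 : r < 1 := by linarith
  have h1r : 1 - r = 1 / s := by rw [hr]; ring
  have hd' : (0 : ℝ) < d := by exact_mod_cast hd
  obtain ⟨G, hG, hGmean⟩ := exists_discounted_sum hd (by linarith) hr1
    (div_pos hγ (by linarith : (0 : ℝ) < N)) hgap
  have hGnorm : ampNorm G ≤ √(2 * d) * N := by
    have h1 : G = unmarked d n + r • realStep 0 G := by rw [← hG]; abel
    have h2 : ampNorm G ≤ ampNorm (unmarked d n) + r * ampNorm G := by
      conv_lhs => rw [h1]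
      refine (ampNorm_add_smul_le _ _ (by linarith)).trans ?_
      rw [ampNorm_realStep hd]
    have h3 : ampNorm G * (1 - r) ≤ √(2 * d) * s := by
      have := ampNorm_unmarked_le (d := d) (n := n)
      linarith
    rw [h1r, mul_one_div, div_le_iff₀ hs_pos] at h3
    rw [← hs2]
    linarith
  -- Since `r ≥ 1 / 2`, the shift `ε` is at most `(1 - r)² = 1 / N`, comparable with the gap `γ /
  -- N`. This is why the discount is taken at scale `√N`.
  have hfrac : γ / (γ + 1) ≤ γ / N / (γ / N + (1 - r) ^ 2 / (2 * r)) := by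
    have hN0 : 0 < N := by linarith
    have h2 : (1 - r) ^ 2 / (2 * r) ≤ 1 / N := by
      rw [h1r, div_pow, one_pow, sq, hs2]
      exact div_le_self (by positivity) (by linarith)
    have h3 : γ / (γ + 1) = γ / N / (γ / N + 1 / N) := by
      field_simp
    rw [h3]
    have : 0 < γ / N := by positivity
    gcongr
  have hlow : q * N ≤ meanAtZero G := by
    refine le_trans ?_ hGmean
    have h1 : 0 ≤ γ / (γ + 1) := by positivity
    have h2 : N / 4 * (γ / (γ + 1)) ≤
        (N - 1) / 2 * (γ / N / (γ / N + (1 - r) ^ 2 / (2 * r))) :=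
      mul_le_mul (by linarith) hfrac h1 (by linarith)
    nlinarith
  by_contra! hcon
  have htel := congrArg meanAtZero (discounted_telescope (realStep 0) r G _ hG T)
  rw [map_sum, map_sub, map_smul, smul_eq_mul] at htel
  simp only [map_smul, smul_eq_mul] at htel
  have hq0 : 0 < q := by
    have : 0 ≤ r ^ T := by positivity
    linarith
  have hsum : ∑ t ∈ Finset.range T, r ^ t *
      meanAtZero ((realStep (0 : Vertex d n) ^ t) (unmarked d n)) ≤ q / 2 * N := by
    calc _ ≤ ∑ t ∈ Finset.range T, r ^ t * (q / 2 * s) := by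
          refine Finset.sum_le_sum fun t ht => mul_le_mul_of_nonneg_left ?_ (by positivity)
          exact (le_abs_self _).trans (hcon t (Finset.mem_range.1 ht)).le
      _ = (∑ t ∈ Finset.range T, r ^ t) * (q / 2 * s) := by rw [Finset.sum_mul]
      _ ≤ s * (q / 2 * s) := by
          refine mul_le_mul_of_nonneg_right ?_ (by positivity)
          have h := geom_sum_mul_neg r T
          rw [h1r, mul_one_div, div_eq_iff hs_pos.ne'] at h
          have : 0 ≤ r ^ T * s := by positivity
          linarith
      _ = q / 2 * N := by rw [← hs2]; ring
  -- The isometry bounds the mean of `U ^ T G` by `N`, the same order as the main term, so `r ^ T <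
  -- q / 2` suffices.
  have htail : r ^ T * meanAtZero ((realStep (0 : Vertex d n) ^ T) G) < q / 2 * N := by
    have h1 : meanAtZero ((realStep (0 : Vertex d n) ^ T) G) ≤ N := by
      refine (le_abs_self _).trans ((abs_meanAtZero_le hd _).trans ?_)
      rw [ampNorm_realStep_pow hd, div_le_iff₀ (by positivity)]
      linarith
    calc _ ≤ r ^ T * N := mul_le_mul_of_nonneg_left h1 (by positivity)
      _ < q / 2 * N := mul_lt_mul_of_pos_right hT (by linarith)
  linarith

/-- The state supported uniformly on the marked vertex contributes a bounded mean amplitude. -/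
lemma abs_meanAtZero_sub_le [NeZero n] (hd : 0 < d) (t : ℕ) :
    |meanAtZero ((realStep (0 : Vertex d n) ^ t) (1 - unmarked d n))| ≤ 1 := by
  have hd' : (0 : ℝ) < d := by exact_mod_cast hd
  refine (abs_meanAtZero_le hd _).trans ?_
  rw [ampNorm_realStep_pow hd, div_le_one (by positivity)]
  refine Real.le_sqrt_of_sq_le (le_of_eq ?_)
  rw [ampNorm_sq, sum_label, Finset.sum_eq_single 0]
  · simp [unmarked]
    ring
  · intro x _ hx
    simp [unmarked, hx]
  · simp

lemma successProb_zero [NeZero n] (hd : 0 < d) (v : Vertex d n) :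
    successProb v 0 = 1 / (n : ℝ) ^ d := by
  have hd' : (d : ℝ) ≠ 0 := by exact_mod_cast hd.ne'
  rw [successProb_eq hd]
  simp
  field_simp

lemma sq_le_successProb [NeZero n] (hd : 0 < d) (v : Vertex d n) (t : ℕ) :
    meanAtZero ((realStep (0 : Vertex d n) ^ t) 1) ^ 2 / (n : ℝ) ^ d ≤ successProb v t := by
  rw [successProb_eq_zero_vertex hd, ← div_div]
  exact div_le_div_of_nonneg_right (meanAtZero_sq_le hd _) (by positivity)

/-- Search succeeds with constant probability after `O(√N)` steps whenever the killed walk has a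
spectral gap of order `1 / N`. -/
lemma exists_search_time (hd : 0 < d) {γ : ℝ} (hγ : 0 < γ)
    (hgap : ∀ (n : ℕ) [NeZero n], 2 ≤ n → ∀ f : Vertex d n → ℝ, f 0 = 0 →
      γ / (n : ℝ) ^ d * ∑ x, f x ^ 2 ≤ ∑ x, f x * (f x - srw f x)) :
    ∃ C p : ℝ, 0 < C ∧ 0 < p ∧ ∀ (n : ℕ) [NeZero n],
      ∃ T : ℕ, (T : ℝ) ≤ C * √((n : ℝ) ^ d) ∧ ∀ v : Vertex d n, p ≤ successProb v T := by
  set q := γ / (γ + 1) / 4 with hq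
  have hq0 : 0 < q := by positivity
  have hq1 : q < 1 := by
    have : γ / (γ + 1) ≤ 1 := div_le_one_of_le₀ (by linarith) (by positivity)
    linarith
  -- With about `l * √N` steps the discount falls to `exp (-l) = q / 4`, below the required `q / 2`.
  set l := Real.log (4 / q) with hl
  have hl0 : 0 < l := Real.log_pos (by rw [lt_div_iff₀ hq0]; linarith)
  refine ⟨l + 1, q ^ 2 / 16, by positivity, by positivity, fun n _ => ?_⟩
  have hn : (1 : ℝ) ≤ n := by exact_mod_cast NeZero.one_le
  have hN1 : 1 ≤ (n : ℝ) ^ d := one_le_pow₀ hn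
  set s := √((n : ℝ) ^ d) with hs
  have hs2 : s ^ 2 = (n : ℝ) ^ d := Real.sq_sqrt (by linarith)
  have hs1 : 1 ≤ s := Real.one_le_sqrt.2 hN1
  -- For bounded `N` no step is needed: the initial probability `1 / N` is already at least `q² /
  -- 16`.
  by_cases hsmall : q * s ≤ 4
  · refine ⟨0, by simp only [Nat.cast_zero]; positivity, fun v => ?_⟩
    rw [successProb_zero hd, le_div_iff₀ (by linarith), ← hs2]
    nlinarith [mul_pos hq0 (by linarith : 0 < s)]
  · push Not at hsmall
    have hs4 : 4 < s := by nlinarith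
    have hN4 : 4 ≤ (n : ℝ) ^ d := by nlinarith
    have hn2 : 2 ≤ n := by
      by_contra hc
      have : n = 1 := by
        have := NeZero.one_le (n := n)
        omega
      subst this
      norm_num at hN4
    have hT : (1 - 1 / s) ^ ⌈s * l⌉₊ < q / 2 := by
      have h1 : 1 - 1 / s ≤ Real.exp (-(1 / s)) := by
        have := Real.add_one_le_exp (-(1 / s))
        linarith
      have h0 : 0 ≤ 1 - 1 / s := by
        rw [sub_nonneg, div_le_one (by linarith)]
        exact hs1
      calc (1 - 1 / s) ^ ⌈s * l⌉₊ ≤ Real.exp (-(1 / s)) ^ ⌈s * l⌉₊ := pow_le_pow_left₀ h0 h1 _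
        _ = Real.exp (-(⌈s * l⌉₊ / s)) := by
            rw [← Real.exp_nat_mul]
            congr 1
            ring
        _ ≤ Real.exp (-l) := by
            refine Real.exp_le_exp.2 (neg_le_neg ?_)
            rw [le_div_iff₀ (by linarith), mul_comm]
            exact Nat.le_ceil _
        _ = q / 4 := by
            rw [Real.exp_neg, hl, Real.exp_log (by positivity), inv_div]
        _ < q / 2 := by linarith
    obtain ⟨t, ht, hbig⟩ := exists_large_meanAtZero hd hγ hN4 (hgap n hn2) (q := q)
      (by rw [hq]; linarith) _ hT
    refine ⟨t, ?_, fun v => ?_⟩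
    · have h1 : (t : ℝ) ≤ ⌈s * l⌉₊ := by exact_mod_cast ht.le
      have h2 := Nat.ceil_lt_add_one (by positivity : 0 ≤ s * l)
      nlinarith
    · refine le_trans ?_ (sq_le_successProb hd v t)
      -- The marked part of the initial vector changes the mean by at most `1`, which is below `q /
      -- 4 * s` because `q * s > 4`.
      have hsplit : (1 : Label d n → ℝ) = unmarked d n + (1 - unmarked d n) := by abel
      have hm : q / 4 * s ≤ |meanAtZero ((realStep (0 : Vertex d n) ^ t) 1)| := by
        rw [hsplit, map_add, map_add]
        have h1 := abs_meanAtZero_sub_le (n := n) hd t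
        have h2 := abs_sub_abs_le_abs_add
          (meanAtZero ((realStep (0 : Vertex d n) ^ t) (unmarked d n)))
          (meanAtZero ((realStep (0 : Vertex d n) ^ t) (1 - unmarked d n)))
        linarith
      rw [le_div_iff₀ (by linarith), ← sq_abs (meanAtZero _), ← hs2]
      calc q ^ 2 / 16 * s ^ 2 = (q / 4 * s) ^ 2 := by ring
        _ ≤ _ := pow_le_pow_left₀ (by positivity) hm 2

end GridSearch

theorem theorem4 (d : ℕ) (hd : 3 ≤ d) :
    (∃ C p : ℝ, 0 < C ∧ 0 < p ∧ ∀ (n : ℕ) [NeZero n],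
      ∃ T : ℕ, (T : ℝ) ≤ C * √((n : ℝ) ^ d) ∧
        ∀ v : GridSearch.Vertex d n, p ≤ GridSearch.successProb v T) ∧
    (∃ a b : ℝ, 0 < a ∧ 0 < b ∧ ∀ (n : ℕ) [NeZero n], 2 ≤ n →
      a * (n : ℝ) ^ d ≤
          ∑ k : Fin d → ZMod n with k ≠ 0, 1 / (1 - Real.cos (GridSearch.modeAngle k)) ∧
        ∑ k : Fin d → ZMod n with k ≠ 0, 1 / (1 - Real.cos (GridSearch.modeAngle k)) ≤
          b * (n : ℝ) ^ d) := by
  have hd0 : (0 : ℝ) < d := by exact_mod_cast (by omega : 0 < d)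
  set b : ℝ := d ^ 2 * 3 ^ (d - 1) / 8 with hb
  have hb0 : 0 < b := by positivity
  -- `γ = 1 / (2 * b)` is the reciprocal of the constant `2 * b` in `dirichlet_gap`.
  refine ⟨GridSearch.exists_search_time (γ := 1 / (2 * b)) (by omega) (by positivity)
    fun n _ _ f hf => ?_, 1 / 4, b, by norm_num, hb0, fun n _ hn =>
    ⟨GridSearch.le_sum_inv_one_sub_cos hd hn, GridSearch.sum_inv_one_sub_cos_le hd⟩⟩
  have hn : (0 : ℝ) < n := by exact_mod_cast NeZero.pos n
  have := GridSearch.dirichlet_gap (by omega) (GridSearch.sum_inv_one_sub_cos_le hd) f hf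
  rw [← hb] at this
  rw [div_div, one_div_mul_eq_div, div_le_iff₀ (by positivity)]
  linarith
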